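/- Let $(X,\mathcal{F},m)$ be a non-atomic Lebesgue probability space, i.e. a probability space without points of positive measure which, up to completion and null sets, is isomorphic to a standard Borel space with a Borel measure. Let $T:X\to X$ be an ergodic automorphism, i.e. a bijection, measurable with measurable inverse, that preserves $m$ and is ergodic. Let $\mathcal{A}$ be the abelian group of measurable sets modulo $m$-null sets, with symmetric difference $A+B=A\,\triangle\,B$ as addition, and with the metric $d(A,B)=m(A+B)$. Let $\mathcal{B}=\{T(B)+B : B\in\mathcal{A}\}\subset\mathcal{A}$ be the subgroup of coboundaries and let $\mathcal{H}=\mathcal{A}/\mathcal{B}$ be the first cohomology group of $T$ with coefficients in $\mathbb{Z}_2$. Then $(\mathcal{A},d)$ is a Polish space, $\mathcal{B}$ is meager in $\mathcal{A}$, and $\mathcal{H}$ is uncountable. -/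

import Mathlib

open MeasureTheory
open scoped symmDiff

universe u

/-- `f : X → Y` and `g : Y → X` are mutually inverse isomorphisms modulo null sets between the
completions of the measure spaces `(X, m)` and `(Y, μ)`. -/
structure IsIsoModNull {X Y : Type*} [MeasurableSpace X] [MeasurableSpace Y]
    (m : Measure X) (μ : Measure Y) (f : X → Y) (g : Y → X) : Prop where
  nullMeasurable_toFun : NullMeasurable f m
  nullMeasurable_invFun : NullMeasurable g μ
  measure_preimage_toFun : ∀ B : Set Y, MeasurableSet B → m (f ⁻¹' B) = μ B
  measure_preimage_invFun : ∀ A : Set X, MeasurableSet A → μ (g ⁻¹' A) = m A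
  left_inv : ∀ᵐ x ∂m, g (f x) = x
  right_inv : ∀ᵐ y ∂μ, f (g y) = y

/-- `(X, m)` is a Lebesgue space (standard measure space): up to completion and null sets, it is
isomorphic to a Borel measure on a standard Borel space. Both Borel measures on standard Borel
spaces and their completions are covered. -/
def IsLebesgueSpace {X : Type u} [MeasurableSpace X] (m : Measure X) : Prop :=
  ∃ (Y : Type u) (_ : MeasurableSpace Y) (_ : StandardBorelSpace Y) (μ : Measure Y)
    (f : X → Y) (g : Y → X), IsIsoModNull m μ f g

theorem isLebesgueSpace_of_standardBorelSpace {X : Type u} [MeasurableSpace X]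
    [StandardBorelSpace X] (m : Measure X) : IsLebesgueSpace m :=
  ⟨X, inferInstance, inferInstance, m, id, id,
    measurable_id.nullMeasurable, measurable_id.nullMeasurable,
    fun _ _ => rfl, fun _ _ => rfl, .of_forall fun _ => rfl, .of_forall fun _ => rfl⟩

noncomputable section

namespace MeasureTheory.MeasuredSets

variable {X : Type u} [MeasurableSpace X] {m : Measure X}

/-- Addition of measurable sets is the symmetric difference. -/
instance : Add (MeasuredSets m) := ⟨fun s t => ⟨(s : Set X) ∆ t, s.2.symmDiff t.2⟩⟩

instance : Zero (MeasuredSets m) := ⟨⟨∅, MeasurableSet.empty⟩⟩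

instance : Neg (MeasuredSets m) := ⟨fun s => s⟩

theorem coe_add (s t : MeasuredSets m) : ((s + t : MeasuredSets m) : Set X) = (s : Set X) ∆ t := rfl

theorem coe_zero : ((0 : MeasuredSets m) : Set X) = ∅ := rfl

theorem coe_neg (s : MeasuredSets m) : ((-s : MeasuredSets m) : Set X) = s := rfl

instance : AddCommGroup (MeasuredSets m) where
  add_assoc s t u := SetLike.coe_injective (symmDiff_assoc (s : Set X) t u)
  zero_add s := SetLike.coe_injective (bot_symmDiff (s : Set X))
  add_zero s := SetLike.coe_injective (symmDiff_bot (s : Set X))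
  neg_add_cancel s := SetLike.coe_injective (symmDiff_self (s : Set X))
  add_comm s t := SetLike.coe_injective (symmDiff_comm (s : Set X) t)
  nsmul := nsmulRec
  zsmul := zsmulRec

theorem edist_add_add_le (s t s' t' : MeasuredSets m) :
    edist (s + t) (s' + t') ≤ edist s s' + edist t t' := by
  simp only [edist_def, coe_add]
  rw [symmDiff_symmDiff_symmDiff_comm]
  refine (measure_mono ?_).trans (measure_union_le _ _)
  exact symmDiff_le_sup

instance : IsTopologicalAddGroup (MeasuredSets m) where
  continuous_add := by
    refine (EMetric.continuous_iff).2 fun p ε hε => ?_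
    refine ⟨ε / 2, ENNReal.half_pos hε.ne', fun q hq => ?_⟩
    calc edist (q.1 + q.2) (p.1 + p.2) ≤ edist q.1 p.1 + edist q.2 p.2 := edist_add_add_le _ _ _ _
      _ < ε / 2 + ε / 2 := ENNReal.add_lt_add (lt_of_le_of_lt (le_max_left _ _) hq)
          (lt_of_le_of_lt (le_max_right _ _) hq)
      _ = ε := ENNReal.add_halves ε
  continuous_neg := continuous_id

end MeasureTheory.MeasuredSets

/-- The group of cocycles `𝒜`: measurable sets modulo null sets, with symmetric difference as
addition and the topology of the distance `d(A, B) = m (A ∆ B)`. The separation quotient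
identifies `A` and `B` exactly when `d(A, B) = 0`. -/
abbrev CocycleGroup {X : Type u} [MeasurableSpace X] (m : Measure X) : Type u :=
  SeparationQuotient (MeasuredSets m)

/-- The coboundary map `B ↦ T(B) + B` on measurable sets. -/
def coboundaryMap {X : Type u} [MeasurableSpace X] (m : Measure X) (T : X ≃ᵐ X) :
    MeasuredSets m →+ MeasuredSets m where
  toFun B := ⟨T '' (B : Set X), T.measurableSet_image.2 B.2⟩ + B
  map_zero' := SetLike.coe_injective (by
    change (T '' (∅ : Set X)) ∆ (∅ : Set X) = ∅
    simp)
  map_add' A B := SetLike.coe_injective (by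
    simp only [MeasuredSets.coe_add]
    change (T '' ((A : Set X) ∆ B)) ∆ ((A : Set X) ∆ B)
      = ((T '' (A : Set X)) ∆ A) ∆ ((T '' (B : Set X)) ∆ B)
    rw [Set.image_symmDiff T.injective, symmDiff_symmDiff_symmDiff_comm])

/-- The group of coboundaries `ℬ`: the classes of the sets `T(B) + B`, `B` measurable. -/
def coboundaryGroup {X : Type u} [MeasurableSpace X] (m : Measure X) (T : X ≃ᵐ X) :
    AddSubgroup (CocycleGroup m) :=
  ((SeparationQuotient.mkAddMonoidHom (M := MeasuredSets m)).comp (coboundaryMap m T)).range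

/-- The first cohomology group `ℋ = 𝒜 / ℬ` of `T` with coefficients in `ℤ/2`. -/
abbrev CohomologyGroup {X : Type u} [MeasurableSpace X] (m : Measure X) (T : X ≃ᵐ X) : Type u :=
  CocycleGroup m ⧸ coboundaryGroup m T

end

/-!
If the subgroup `ℬ` of coboundaries were not meager, the open mapping theorem for complete separable
groups would make the coboundary map `B ↦ T(B) + B` open. Every coboundary of small measure would
then be the coboundary of a set of small measure; since by ergodicity the kernel is `{∅, X}`, every
almost invariant set would have almost zero or almost full measure. But the sets `E ∪ T E ∪ ⋯ ∪ TⁿE`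
with `E` small are almost invariant and their measures grow to that of `X` by small steps, so one of
them has about half of the full measure. Finally, if `ℋ` were countable, `𝒜` would be a countable
union of translates of `ℬ`, against the Baire category theorem.
-/

open Set Filter Topology TopologicalSpace
open scoped ENNReal

section OpenMapping

theorem tendsto_of_mem_closure_image_eball {ι E Z : Type*} [PseudoEMetricSpace E]
    [TopologicalSpace Z] [RegularSpace Z] {f : E → Z} {x : E} (hf : ContinuousAt f x)
    {l : Filter ι} {r : ι → ℝ≥0∞} (hr : Tendsto r l (𝓝 0)) {z : ι → Z}
    (hz : ∀ i, z i ∈ closure (f '' Metric.eball x (r i))) : Tendsto z l (𝓝 (f x)) := by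
  refine (closed_nhds_basis (f x)).tendsto_right_iff.2 fun W ⟨hW, hW_closed⟩ => ?_
  obtain ⟨ρ, hρ, hρW⟩ := EMetric.mem_nhds_iff.1 (hf hW)
  filter_upwards [hr.eventually_lt_const hρ] with i hi
  refine closure_minimal (image_subset_iff.2 ?_) hW_closed (hz i)
  exact (Metric.eball_subset_eball hi.le).trans hρW

variable {G H : Type*} [Group G] [Group H] [TopologicalSpace H] [IsTopologicalGroup H] {φ : G →* H}

@[to_additive]
theorem closure_image_mem_nhds_one_of_not_isMeagre_range [TopologicalSpace G]
    [IsTopologicalGroup G] [SeparableSpace G] (hφ : ¬ IsMeagre (range φ))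
    {U : Set G} (hU : U ∈ 𝓝 1) : closure (φ '' U) ∈ 𝓝 1 := by
  obtain ⟨V, hV, hVU⟩ := exists_nhds_split_inv hU
  obtain ⟨S, hS, hS_dense⟩ := exists_countable_dense G
  have range_subset : range φ ⊆ ⋃ s ∈ S, φ '' {g | g / s ∈ V} := by
    rintro _ ⟨g, rfl⟩
    have hg : ∀ᶠ s in 𝓝 g, g / s ∈ V :=
      (continuous_const.div' continuous_id).tendsto' g 1 (div_self' g) hV
    obtain ⟨s, hs, hgs⟩ := hS_dense.inter_nhds_nonempty hg
    exact mem_biUnion hs ⟨g, hgs, rfl⟩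
  obtain ⟨s, -, hs⟩ := exists_of_not_isMeagre_biUnion hS fun h => hφ (h.mono range_subset)
  obtain ⟨z, hz⟩ : (interior (closure (φ '' {g | g / s ∈ V}))).Nonempty := by
    rw [nonempty_iff_ne_empty]
    exact fun h => hs (IsNowhereDense.isMeagre h)
  have hwz : ∀ᶠ w in 𝓝 (1 : H), w * z ∈ interior (closure (φ '' {g | g / s ∈ V})) :=
    (continuous_mul_const z).tendsto' 1 z (one_mul z) (isOpen_interior.mem_nhds hz)
  filter_upwards [hwz] with w hw
  rw [← mul_div_cancel_right w z]
  refine map_mem_closure₂ continuous_div' (interior_subset hw) (interior_subset hz) ?_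
  rintro _ ⟨a, ha, rfl⟩ _ ⟨b, hb, rfl⟩
  refine ⟨a / b, ?_, map_div φ a b⟩
  rw [← div_div_div_cancel_right a b s]
  exact hVU _ ha _ hb

variable [PseudoEMetricSpace G] [IsIsometricSMul G G]

@[to_additive]
theorem exists_edist_lt_inv_map_mul_mem_closure_image_eball_one {r r' : ℝ≥0∞}
    (hr' : closure (φ '' Metric.eball 1 r') ∈ 𝓝 1) {s : G} {y : H}
    (hs : (φ s)⁻¹ * y ∈ closure (φ '' Metric.eball 1 r)) :
    ∃ t, edist s t < r ∧ (φ t)⁻¹ * y ∈ closure (φ '' Metric.eball 1 r') := by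
  have hnear : ∀ᶠ w in 𝓝 ((φ s)⁻¹ * y),
      w⁻¹ * ((φ s)⁻¹ * y) ∈ closure (φ '' Metric.eball 1 r') :=
    (continuous_inv.mul continuous_const).tendsto' _ 1 (inv_mul_cancel _) hr'
  obtain ⟨_, hg_near, g, hg, rfl⟩ := mem_closure_iff_nhds.1 hs _ hnear
  refine ⟨s * g, ?_, by simpa [mul_assoc] using hg_near⟩
  calc edist s (s * g) = edist (s * 1) (s * g) := by rw [mul_one]
    _ = edist 1 g := edist_mul_left s 1 g
    _ < r := Metric.mem_eball'.1 hg

@[to_additive]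
theorem closure_image_eball_one_subset_image_closedEBall [CompleteSpace G] [T2Space H]
    (hφ : Continuous φ) (hball : ∀ r > 0, closure (φ '' Metric.eball 1 r) ∈ 𝓝 1) {r : ℝ≥0∞}
    (hr : r ≠ 0) (hr' : r ≠ ∞) :
    closure (φ '' Metric.eball 1 r) ⊆ φ '' Metric.closedEBall 1 (2 * r) := by
  intro y hy
  have hr_pos (n : ℕ) : 0 < r / 2 ^ n := ENNReal.div_pos hr (by finiteness)
  -- Successive approximation: moving `s` by less than `r / 2 ^ n` halves the radius of the ball whose
  -- image contains the error `(φ s)⁻¹ * y` in its closure.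
  choose! next hnext_edist hnext_mem using fun (n : ℕ) (s : G)
    (hs : (φ s)⁻¹ * y ∈ closure (φ '' Metric.eball 1 (r / 2 ^ n))) =>
    exists_edist_lt_inv_map_mul_mem_closure_image_eball_one (hball _ (hr_pos (n + 1))) hs
  let s : ℕ → G := fun n => Nat.rec 1 next n
  have hs_mem (n : ℕ) : (φ (s n))⁻¹ * y ∈ closure (φ '' Metric.eball 1 (r / 2 ^ n)) := by
    induction n with
    | zero => simpa [s] using hy
    | succ n ih => exact hnext_mem n _ ih
  have hs_edist (n : ℕ) : edist (s n) (s (n + 1)) ≤ r / 2 ^ n := (hnext_edist n _ (hs_mem n)).le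
  obtain ⟨g, hg⟩ :=
    cauchySeq_tendsto_of_complete (cauchySeq_of_edist_le_geometric_two r hr' hs_edist)
  have hr_lim : Tendsto (fun n : ℕ => r / 2 ^ n) atTop (𝓝 0) := by
    simpa [div_eq_mul_inv, ENNReal.inv_pow] using ENNReal.Tendsto.const_mul
      (ENNReal.tendsto_pow_atTop_nhds_zero_of_lt_one (r := 2⁻¹) (by simp)) (.inr hr')
  have hlim_one : Tendsto (fun n => (φ (s n))⁻¹ * y) atTop (𝓝 1) := by
    simpa using tendsto_of_mem_closure_image_eball hφ.continuousAt hr_lim hs_mem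
  have hlim : Tendsto (fun n => (φ (s n))⁻¹ * y) atTop (𝓝 ((φ g)⁻¹ * y)) :=
    (((hφ.tendsto g).comp hg).inv).mul_const y
  refine ⟨g, ?_, inv_mul_eq_one.1 (tendsto_nhds_unique hlim hlim_one)⟩
  exact Metric.mem_closedEBall'.2 (edist_le_of_edist_le_geometric_two_of_tendsto₀ r hs_edist hg)

@[to_additive]
theorem monoidHom_isOpenMap_of_not_isMeagre_range [IsTopologicalGroup G] [CompleteSpace G]
    [SeparableSpace G] [T2Space H] (hφ : Continuous φ) (hrange : ¬ IsMeagre (range φ)) :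
    IsOpenMap φ := by
  have hball (r : ℝ≥0∞) (hr : 0 < r) : closure (φ '' Metric.eball 1 r) ∈ 𝓝 1 :=
    closure_image_mem_nhds_one_of_not_isMeagre_range hrange (Metric.eball_mem_nhds 1 hr)
  refine IsTopologicalGroup.isOpenMap_iff_nhds_one.2 fun s hs => ?_
  obtain ⟨ε, hε, hεs⟩ := Metric.nhds_basis_closedEBall.mem_iff.1 (mem_map.1 hs)
  obtain ⟨r, hr, hrε⟩ := ENNReal.exists_pos_mul_lt (ENNReal.ofNat_ne_top (n := 2)) hε.ne'
  have hr_top : r ≠ ∞ := by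
    rintro rfl
    simp at hrε
  refine mem_of_superset (hball r hr)
    ((closure_image_eball_one_subset_image_closedEBall hφ hball hr.ne' hr_top).trans ?_)
  rw [image_subset_iff, mul_comm]
  exact (Metric.closedEBall_subset_closedEBall hrε.le).trans hεs

end OpenMapping

open scoped Pointwise in
@[to_additive]
theorem uncountable_quotient_of_isMeagre_subgroup {G : Type*} [Group G] [TopologicalSpace G]
    [ContinuousConstSMul G G] [BaireSpace G] {N : Subgroup G} (hN : IsMeagre (N : Set G)) :
    Uncountable (G ⧸ N) := by
  by_contra hcount
  rw [not_uncountable_iff] at hcount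
  have coset_isMeagre (q : G ⧸ N) : IsMeagre (q.out • (N : Set G)) :=
    (Homeomorph.smul q.out).isInducing.isMeagre_image hN
  have univ_subset : univ ⊆ ⋃ q : G ⧸ N, q.out • (N : Set G) := fun g _ => mem_iUnion.2 ⟨g,
    mem_smul_set_iff_inv_smul_mem.2 (QuotientGroup.eq.1 (QuotientGroup.out_eq' _))⟩
  exact not_isMeagre_of_isOpen (X := G) isOpen_univ univ_nonempty
    ((isMeagre_iUnion coset_isMeagre).mono univ_subset)

section MeasuredSets

variable {X : Type*} [MeasurableSpace X] {m : Measure X}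

theorem edist_measuredSets_zero_right (s : MeasuredSets m) : edist s 0 = m s := by
  rw [MeasuredSets.edist_def, MeasuredSets.coe_zero, ← bot_eq_empty, symmDiff_bot]

instance : IsIsometricVAdd (MeasuredSets m) (MeasuredSets m) where
  isometry_vadd c s t := by
    simp only [vadd_eq_add, MeasuredSets.edist_def, MeasuredSets.coe_add]
    rw [symmDiff_symmDiff_symmDiff_comm, symmDiff_self, bot_symmDiff]

theorem symmDiff_limsup_subset_iUnion {α : Type*} (s : ℕ → Set α) (n : ℕ) :
    s n ∆ limsup s atTop ⊆ ⋃ k, s (k + n) ∆ s (k + n + 1) := by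
  intro x hx
  by_contra! hcon
  have hconst (k : ℕ) : x ∈ s (k + n) ↔ x ∈ s n := by
    induction k with
    | zero => rw [zero_add]
    | succ k ih =>
      have hk : x ∉ s (k + n) ∆ s (k + n + 1) := fun h => hcon (mem_iUnion_of_mem k h)
      rw [← ih, Nat.add_right_comm]
      rw [mem_symmDiff] at hk
      tauto
  have hlimsup : x ∈ limsup s atTop ↔ x ∈ s n := by
    rw [mem_limsup_iff_frequently_mem,
      frequently_congr ((eventually_ge_atTop n).mono fun k hk => Nat.sub_add_cancel hk ▸ hconst _),
      frequently_const]
  rw [mem_symmDiff] at hx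
  tauto

theorem exists_tendsto_measuredSets_of_tsum_edist_ne_top {s : ℕ → MeasuredSets m}
    (hs : ∑' n, edist (s n) (s (n + 1)) ≠ ∞) : ∃ t, Tendsto s atTop (𝓝 t) := by
  let t : MeasuredSets m :=
    ⟨limsup (fun n => (s n : Set X)) atTop, .measurableSet_limsup fun n => (s n).2⟩
  refine ⟨t, tendsto_iff_edist_tendsto_0.2 ?_⟩
  refine tendsto_of_tendsto_of_tendsto_of_le_of_le tendsto_const_nhds
    (ENNReal.tendsto_sum_nat_add _ hs) (fun _ => zero_le) fun n => ?_
  calc m ((s n : Set X) ∆ t) ≤ m (⋃ k, (s (k + n) : Set X) ∆ s (k + n + 1)) :=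
        measure_mono (symmDiff_limsup_subset_iUnion (fun k => (s k : Set X)) n)
    _ ≤ ∑' k, m ((s (k + n) : Set X) ∆ s (k + n + 1)) := measure_iUnion_le _

instance : CompleteSpace (MeasuredSets m) := by
  refine EMetric.complete_of_convergent_controlled_sequences (fun n => 2⁻¹ ^ n)
    (fun n => ENNReal.pow_pos (by simp) n) fun s hs => ?_
  refine exists_tendsto_measuredSets_of_tsum_edist_ne_top (ne_top_of_le_ne_top ?_
    (ENNReal.tsum_le_tsum fun n => (hs n n (n + 1) le_rfl n.le_succ).le))
  simp [ENNReal.tsum_geometric]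

instance [IsFiniteMeasure m] [IsSeparable m] : SeparableSpace (MeasuredSets m) := by
  obtain ⟨C, hC, hC_dense⟩ := exists_countable_measureDense m
  refine ⟨(↑) ⁻¹' C, hC.preimage SetLike.coe_injective, EMetric.dense_iff.2 fun s ε hε => ?_⟩
  obtain ⟨r, -, hr, hrε⟩ := ENNReal.lt_iff_exists_real_btwn.1 hε
  obtain ⟨c, hc, hsc⟩ := hC_dense.approx s s.2 (measure_ne_top m _) r (ENNReal.ofReal_pos.1 hr)
  exact ⟨⟨c, hC_dense.measurable c hc⟩, Metric.mem_eball'.2 (hsc.trans hrε), hc⟩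

theorem separableSpace_measuredSets_of_measure_preimage {Y : Type*} [MeasurableSpace Y]
    {μ : Measure Y} [SeparableSpace (MeasuredSets μ)] {g : Y → X} (hg : NullMeasurable g μ)
    (hg_measure : ∀ A, MeasurableSet A → μ (g ⁻¹' A) = m A) :
    SeparableSpace (MeasuredSets m) := by
  let pullback : MeasuredSets m → MeasuredSets μ := fun A =>
    ⟨toMeasurable μ (g ⁻¹' A), measurableSet_toMeasurable _ _⟩
  have hpullback (A : MeasuredSets m) : (pullback A : Set Y) =ᵐ[μ] g ⁻¹' A :=
    NullMeasurableSet.toMeasurable_ae_eq (hg A.2)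
  have isometry_pullback : Isometry pullback := fun A B =>
    calc μ ((pullback A : Set Y) ∆ pullback B) = μ ((g ⁻¹' (A : Set X)) ∆ (g ⁻¹' B)) :=
          measure_congr (ae_eq_set_symmDiff (hpullback A) (hpullback B))
      _ = m (A ∆ B : Set X) := hg_measure _ (A.2.symmDiff B.2)
  have := UniformSpace.secondCountable_of_separable (MeasuredSets μ)
  have := isometry_pullback.isUniformInducing.isInducing.secondCountableTopology
  infer_instance

instance [SeparableSpace (MeasuredSets m)] : PolishSpace (CocycleGroup m) := by
  have : SeparableSpace (CocycleGroup m) :=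
    SeparationQuotient.surjective_mk.denseRange.separableSpace SeparationQuotient.continuous_mk
  have := UniformSpace.secondCountable_of_separable (CocycleGroup m)
  infer_instance

end MeasuredSets

theorem exists_isOpen_measure_pos_lt {Y : Type*} [TopologicalSpace Y] [SecondCountableTopology Y]
    [MeasurableSpace Y] {μ : Measure Y} [μ.OuterRegular] [NullSingletonClass μ] (hμ : μ ≠ 0)
    {ε : ℝ≥0∞} (hε : 0 < ε) : ∃ U, IsOpen U ∧ 0 < μ U ∧ μ U < ε := by
  obtain ⟨y, -, hy⟩ :=
    exists_mem_forall_mem_nhdsWithin_pos_measure (Measure.measure_univ_ne_zero.2 hμ)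
  obtain ⟨U, hyU, hU, hUε⟩ := ({y} : Set Y).exists_isOpen_lt_of_lt (μ := μ) ε
    (by rwa [measure_singleton])
  exact ⟨U, hU, hy U (mem_nhdsWithin_of_mem_nhds (hU.mem_nhds (hyU rfl))), hUε⟩

namespace IsIsoModNull

variable {X Y : Type*} [MeasurableSpace X] [MeasurableSpace Y] {m : Measure X} {μ : Measure Y}
  {f : X → Y} {g : Y → X}

theorem measure_univ_eq (h : IsIsoModNull m μ f g) : m univ = μ univ :=
  h.measure_preimage_toFun univ .univ

theorem nullSingletonClass [NullSingletonClass m] [MeasurableSingletonClass Y]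
    (h : IsIsoModNull m μ f g) : NullSingletonClass μ where
  measure_singleton y := by
    have hsub : f ⁻¹' {y} ≤ᵐ[m] ({g y} : Set X) := by
      filter_upwards [h.left_inv] with x hx hxy
      exact hx.symm.trans (congrArg g hxy)
    rw [← h.measure_preimage_toFun _ (measurableSet_singleton y)]
    exact measure_mono_null_ae hsub (measure_singleton _)

end IsIsoModNull

namespace IsLebesgueSpace

variable {X : Type u} [MeasurableSpace X] {m : Measure X} [IsFiniteMeasure m]

theorem separableSpace_measuredSets (h : IsLebesgueSpace m) :
    SeparableSpace (MeasuredSets m) := by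
  obtain ⟨Y, _, _, μ, f, g, hfg⟩ := h
  have : IsFiniteMeasure μ := ⟨hfg.measure_univ_eq ▸ measure_lt_top m univ⟩
  exact separableSpace_measuredSets_of_measure_preimage hfg.nullMeasurable_invFun
    hfg.measure_preimage_invFun

theorem exists_measurableSet_measure_pos_lt [NullSingletonClass m] (h : IsLebesgueSpace m)
    (hm : m ≠ 0) {ε : ℝ≥0∞} (hε : 0 < ε) : ∃ s, MeasurableSet s ∧ 0 < m s ∧ m s < ε := by
  obtain ⟨Y, _, _, μ, f, g, hfg⟩ := h
  let := upgradeStandardBorel Y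
  have : IsFiniteMeasure μ := ⟨hfg.measure_univ_eq ▸ measure_lt_top m univ⟩
  have := hfg.nullSingletonClass
  have hμ : μ ≠ 0 := by
    rwa [← Measure.measure_univ_ne_zero, ← hfg.measure_univ_eq, Measure.measure_univ_ne_zero]
  obtain ⟨U, hU, hU_pos, hU_lt⟩ := exists_isOpen_measure_pos_lt hμ hε
  refine ⟨toMeasurable m (f ⁻¹' U), measurableSet_toMeasurable _ _, ?_⟩
  rw [measure_toMeasurable, hfg.measure_preimage_toFun _ hU.measurableSet]
  exact ⟨hU_pos, hU_lt⟩

end IsLebesgueSpace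

section AlmostInvariantSets

variable {X : Type*}

/-- The set `E ∪ T E ∪ ⋯ ∪ Tⁿ⁻¹ E` swept out by the first `n` translates of `E` under `T`. -/
def sweep (T : X → X) (E : Set X) : ℕ → Set X
  | 0 => ∅
  | n + 1 => E ∪ T '' sweep T E n

theorem monotone_sweep (T : X → X) (E : Set X) : Monotone (sweep T E) := by
  refine monotone_nat_of_le_succ fun n => ?_
  induction n with
  | zero => exact empty_subset _
  | succ n ih => exact union_subset_union_right E (image_mono ih)

variable [MeasurableSpace X] {m : Measure X} {T : X ≃ᵐ X} {E : Set X}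

theorem measurableSet_sweep (hE : MeasurableSet E) (n : ℕ) : MeasurableSet (sweep T E n) := by
  induction n with
  | zero => exact .empty
  | succ n ih => exact hE.union (T.measurableSet_image.2 ih)

theorem measure_image_of_measurePreserving (hT : MeasurePreserving T m m) (s : Set X) :
    m (T '' s) = m s := by
  rw [T.image_eq_preimage_symm, hT.symm.measure_preimage_equiv]

theorem measure_sweep_succ_le (hT : MeasurePreserving T m m) (n : ℕ) :
    m (sweep T E (n + 1)) ≤ m (sweep T E n) + m E :=
  calc m (sweep T E (n + 1)) ≤ m E + m (T '' sweep T E n) := measure_union_le _ _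
    _ = m (sweep T E n) + m E := by rw [measure_image_of_measurePreserving hT, add_comm]

theorem measure_image_symmDiff_le_two_mul [IsFiniteMeasure m] (hT : MeasurePreserving T m m)
    {s : Set X} (hs : MeasurableSet s) (hsE : s ⊆ E ∪ T '' s) :
    m ((T '' s) ∆ s) ≤ 2 * m E := by
  have hle : m (s \ T '' s) ≤ m E := measure_mono (sdiff_subset_iff.2 (union_comm _ _ ▸ hsE))
  have hsymm : m (T '' s \ s) = m (s \ T '' s) :=
    measure_sdiff_symm (T.measurableSet_image.2 hs).nullMeasurableSet hs.nullMeasurableSet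
      (measure_image_of_measurePreserving hT s) (measure_ne_top m _)
  calc m ((T '' s) ∆ s) ≤ m (T '' s \ s) + m (s \ T '' s) := measure_union_le _ _
    _ ≤ m E + m E := add_le_add (hsymm.trans_le hle) hle
    _ = 2 * m E := (two_mul _).symm

theorem measure_iUnion_sweep [IsFiniteMeasure m] (hT : Ergodic T m) (hE : MeasurableSet E)
    (hE_pos : m E ≠ 0) : m (⋃ n, sweep T E n) = m univ := by
  have hinv : T '' (⋃ n, sweep T E n) ⊆ ⋃ n, sweep T E n := by
    rw [image_iUnion]
    exact iUnion_subset fun n => subset_iUnion_of_subset (n + 1) subset_union_right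
  have hE_sub : E ⊆ ⋃ n, sweep T E n := subset_iUnion_of_subset 1 subset_union_left
  rcases hT.ae_empty_or_univ_of_image_ae_le
    (MeasurableSet.iUnion (measurableSet_sweep hE)).nullMeasurableSet hinv.eventuallyLE with h | h
  · exact absurd (measure_mono_null hE_sub (by rw [measure_congr h, measure_empty])) hE_pos
  · exact measure_congr h

theorem exists_measure_sweep_mem_Ioc [IsFiniteMeasure m] (hT : Ergodic T m)
    (hE : MeasurableSet E) (hE_pos : m E ≠ 0) {c : ℝ≥0∞} (hc : c < m univ) :
    ∃ n, m (sweep T E n) ∈ Ioc c (c + m E) := by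
  have hlim := tendsto_measure_iUnion_atTop (μ := m) (monotone_sweep T E)
  rw [measure_iUnion_sweep hT hE hE_pos] at hlim
  obtain ⟨n, hn, hn_succ⟩ :=
    Nat.exists_not_and_succ_of_not_zero_of_exists (p := fun n => c < m (sweep T E n))
      (by simp [sweep]) (hlim.eventually_const_lt hc).exists
  refine ⟨n + 1, hn_succ, ?_⟩
  grw [measure_sweep_succ_le hT.toMeasurePreserving, not_lt.1 hn]

theorem exists_measure_mem_Ioc_measure_image_symmDiff_le [IsFiniteMeasure m] (hT : Ergodic T m)
    (hE : MeasurableSet E) (hE_pos : m E ≠ 0) {c : ℝ≥0∞} (hc : c < m univ) :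
    ∃ D : MeasuredSets m, m D ∈ Ioc c (c + m E) ∧ m ((T '' D) ∆ D) ≤ 2 * m E := by
  obtain ⟨n, hn⟩ := exists_measure_sweep_mem_Ioc hT hE hE_pos hc
  exact ⟨⟨sweep T E n, measurableSet_sweep hE n⟩, hn, measure_image_symmDiff_le_two_mul
    hT.toMeasurePreserving (measurableSet_sweep hE n) (monotone_sweep T E n.le_succ)⟩

end AlmostInvariantSets

section Coboundaries

variable {X : Type u} [MeasurableSpace X] {m : Measure X} {T : X ≃ᵐ X}

/-- The coboundary map with values in the group of cocycles, whose range is the group of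
coboundaries. It is kept on measurable sets, rather than on their classes, since these already form
a complete group. -/
noncomputable def coboundaryHom (m : Measure X) (T : X ≃ᵐ X) : MeasuredSets m →+ CocycleGroup m :=
  (SeparationQuotient.mkAddMonoidHom (M := MeasuredSets m)).comp (coboundaryMap m T)

theorem coe_coboundaryGroup : (coboundaryGroup m T : Set (CocycleGroup m)) =
    range (coboundaryHom m T) :=
  AddMonoidHom.coe_range _

theorem continuous_coboundaryHom (hT : MeasurePreserving T m m) :
    Continuous (coboundaryHom m T) := by
  refine SeparationQuotient.continuous_mk.comp
    (Continuous.add (Isometry.continuous fun s t => ?_) continuous_id)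
  calc m ((T '' s) ∆ (T '' t)) = m (T '' (s ∆ t)) := by rw [image_symmDiff T.injective]
    _ = m (s ∆ t) := measure_image_of_measurePreserving hT _

theorem edist_coboundaryHom_zero (B : MeasuredSets m) :
    edist (coboundaryHom m T B) 0 = m ((T '' B) ∆ B) :=
  (SeparationQuotient.edist_mk _ _).trans (edist_measuredSets_zero_right (coboundaryMap m T B))

theorem ae_eq_empty_or_univ_of_coboundaryHom_eq_zero [IsFiniteMeasure m] (hT : Ergodic T m)
    {B : MeasuredSets m} (hB : coboundaryHom m T B = 0) :
    (B : Set X) =ᵐ[m] (∅ : Set X) ∨ (B : Set X) =ᵐ[m] univ := by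
  have hinv : m ((T '' B) ∆ B) = 0 := by rw [← edist_coboundaryHom_zero, hB, edist_self]
  exact hT.ae_empty_or_univ_of_image_ae_le (MeasurableSet.nullMeasurableSet B.2)
    (measure_symmDiff_eq_zero_iff.1 hinv).le

theorem measure_eq_or_measure_univ_le_of_coboundaryHom_eq [IsFiniteMeasure m] (hT : Ergodic T m)
    {B D : MeasuredSets m} (hBD : coboundaryHom m T B = coboundaryHom m T D) :
    m B = m D ∨ m univ ≤ m B + m D := by
  have hsub : coboundaryHom m T (B - D) = 0 := by rw [map_sub, hBD, sub_self]
  rcases ae_eq_empty_or_univ_of_coboundaryHom_eq_zero hT hsub with h | h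
  · exact .inl (measure_congr (measure_symmDiff_eq_zero_iff.1 (ae_eq_empty.1 h)))
  · right
    calc m univ = m ((B : Set X) ∆ D) := (measure_congr h).symm
      _ ≤ m (B ∪ D : Set X) := measure_mono symmDiff_le_sup
      _ ≤ m B + m D := measure_union_le _ _

theorem not_isOpenMap_coboundaryHom [IsFiniteMeasure m]
    (hm : ∀ ε > 0, ∃ s, MeasurableSet s ∧ 0 < m s ∧ m s < ε) (hT : Ergodic T m) :
    ¬ IsOpenMap (coboundaryHom m T) := by
  intro hopen
  have hm_univ : m univ ≠ 0 := by
    obtain ⟨s, -, hs, -⟩ := hm 1 one_pos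
    exact (hs.trans_le (measure_mono (subset_univ s))).ne'
  set c := m univ / 2 with hc
  have hc_pos : 0 < c / 2 := ENNReal.half_pos (ENNReal.half_pos hm_univ).ne'
  obtain ⟨δ, hδ, hδ_image⟩ := EMetric.mem_nhds_iff.1
    (map_zero (coboundaryHom m T) ▸ hopen.image_mem_nhds (Metric.eball_mem_nhds 0 hc_pos))
  obtain ⟨E, hE, hE_pos, hE_lt⟩ :=
    hm (min (c / 2) (δ / 2)) (lt_min hc_pos (ENNReal.half_pos hδ.ne'))
  obtain ⟨hEc, hEδ⟩ := lt_min_iff.1 hE_lt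
  obtain ⟨D, ⟨hcD, hDc⟩, hD_inv⟩ := exists_measure_mem_Ioc_measure_image_symmDiff_le hT hE
    hE_pos.ne' (ENNReal.half_lt_self hm_univ (measure_ne_top m univ))
  have hD_mem : coboundaryHom m T D ∈ Metric.eball 0 δ := by
    rw [Metric.mem_eball, edist_coboundaryHom_zero]
    calc m ((T '' D) ∆ D) ≤ m E + m E := hD_inv.trans_eq (two_mul _)
      _ < δ / 2 + δ / 2 := ENNReal.add_lt_add hEδ hEδ
      _ = δ := ENNReal.add_halves δ
  obtain ⟨B, hB, hBD⟩ := hδ_image hD_mem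
  rw [Metric.mem_eball, edist_measuredSets_zero_right] at hB
  rcases measure_eq_or_measure_univ_le_of_coboundaryHom_eq hT hBD with h | h
  · exact (hB.trans_le ENNReal.half_le_self).not_gt (h ▸ hcD)
  · refine h.not_gt ?_
    calc m B + m D ≤ m B + (c + m E) := by gcongr
      _ < c / 2 + (c + c / 2) :=
        ENNReal.add_lt_add hB (ENNReal.add_lt_add_left (by finiteness) hEc)
      _ = c + (c / 2 + c / 2) := by abel
      _ = m univ := by rw [ENNReal.add_halves, hc, ENNReal.add_halves]

theorem isMeagre_coboundaryGroup [IsFiniteMeasure m] [SeparableSpace (MeasuredSets m)]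
    (hm : ∀ ε > 0, ∃ s, MeasurableSet s ∧ 0 < m s ∧ m s < ε) (hT : Ergodic T m) :
    IsMeagre (coboundaryGroup m T : Set (CocycleGroup m)) := by
  by_contra hrange
  rw [coe_coboundaryGroup] at hrange
  exact not_isOpenMap_coboundaryHom hm hT (addMonoidHom_isOpenMap_of_not_isMeagre_range
    (continuous_coboundaryHom hT.toMeasurePreserving) hrange)

end Coboundaries

theorem mainTheorem1_general {X : Type u} [MeasurableSpace X] (m : Measure X) [IsFiniteMeasure m]
    [SeparableSpace (MeasuredSets m)] (hm : ∀ ε > 0, ∃ s, MeasurableSet s ∧ 0 < m s ∧ m s < ε)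
    (T : X ≃ᵐ X) (hT : Ergodic T m) :
    PolishSpace (CocycleGroup m) ∧
      IsMeagre (coboundaryGroup m T : Set (CocycleGroup m)) ∧
      Uncountable (CohomologyGroup m T) :=
  have hmeagre := isMeagre_coboundaryGroup hm hT
  ⟨inferInstance, hmeagre, uncountable_quotient_of_isMeagre_addSubgroup hmeagre⟩

theorem mainTheorem1 {X : Type u} [MeasurableSpace X] (m : Measure X) [IsProbabilityMeasure m]
    [NullSingletonClass m] (hm : IsLebesgueSpace m) (T : X ≃ᵐ X) (hT : Ergodic T m) :
    PolishSpace (CocycleGroup m) ∧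
      IsMeagre (coboundaryGroup m T : Set (CocycleGroup m)) ∧
      Uncountable (CohomologyGroup m T) :=
  have := hm.separableSpace_measuredSets
  mainTheorem1_general m (fun _ => hm.exists_measurableSet_measure_pos_lt (NeZero.ne m)) T hT
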